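/- Let $\mathcal{A}$ be the CAR $C^*$-algebra over $\mathbb{Z}$, generated by fermion annihilation operators $a_i$ ($i\in\mathbb{Z}$) with $\{a_i,a_j\}=0$, $\{a_i,a_j^*\}=\delta_{ij}$; let $n_i=a_i^*a_i$, let $\mathcal{A}_\circ$ be the union of the local algebras $\mathcal{A}(I)$ generated by $a_i,a_i^*$ ($i\in I$), $I\subset\mathbb{Z}$ finite, and let $\gamma$ be the automorphism with $\gamma(a_i)=-a_i$. The Nicolai model is given by the formal supercharge $Q=\sum_{i\in\mathbb{Z}}q_i$, $q_i=a_{2i+1}a_{2i}^*a_{2i-1}$, and the formal Hamiltonian $H=QQ^*+Q^*Q$. They define $\delta(A)=QA-\gamma(A)Q$ and $d(A)=[H,A]$ for $A\in\mathcal{A}_\circ$. The closure of $d$ generates the time evolution. For a configuration $g:\mathbb{Z}\to\{0,1\}$ let $\psi_g$ be the classical state on $\mathcal{A}$ given by the infinite product vector $|g\rangle=\cdots\otimes|g(i-1)\rangle\otimes|g(i)\rangle\otimes|g(i+1)\rangle\otimes\cdots$. A classical supersymmetric ground state of the Nicolai model is a classical state $\varphi=\psi_g$ that is supersymmetric, i.e.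 $\varphi(\delta(A))=0$ for all $A\in\mathcal{A}_\circ$, and is a ground state for the time evolution, i.e. $\varphi(A^*\bar d(A))\ge 0$ for all $A$ in the domain of the closure $\bar d$ of $d$. Consider also the classical spin model on the configurations $g:\mathbb{Z}\to\{0,1\}$, $n_i=g(i)$, with $$H_{\rm classical}=\sum_{i\in\mathbb{Z}}\bigl(n_{2i}-n_{2i-1}n_{2i}-n_{2i}n_{2i+1}+n_{2i-1}n_{2i+1}\bigr).$$ Theorem. Under the injective map $g\mapsto\psi_g$, the set of all classical supersymmetric ground states of the Nicolai model over $\mathbb{Z}$ is identical to the set of all ground states of this classical spin model. This holds both when a ground state of the spin model means a configuration whose energy cannot be lowered by changing it at finitely many sites, and when it means a configuration that minimizes the total energy $H_{\rm classical}\in[0,\infty]$ among all configurations. -/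

import Mathlib

namespace Nicolai

noncomputable section

open scoped ComplexOrder

/-! ### Classical configurations and the infinite product vectors -/

/-- A classical configuration over `ℤ`: `g i = true` means that the site `i` is occupied
(the value `1`), `g i = false` means that it is empty (the value `0`). -/
abbrev Config : Type := ℤ → Bool

/-- The Hilbert space spanned by the orthonormal family of all infinite product vectors
`⋯ ⊗ |g(i-1)⟩ ⊗ |g(i)⟩ ⊗ |g(i+1)⟩ ⊗ ⋯`, one for each classical configuration `g`. -/
abbrev Hilb : Type := lp (fun _ : Config => ℂ) 2

open Classical in
/-- The product vector `|g⟩`. -/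
def ket (g : Config) : Hilb := lp.single 2 g (1 : ℂ)

/-- The sites that precede `i` in the enumeration `0, -1, 1, -2, 2, -3, 3, …` of `ℤ`. -/
def before (i : ℤ) : Finset ℤ := if 0 < i then Finset.Ico (-i) i else Finset.Ioo i (-i)

/-- The Jordan–Wigner sign `∏_{j before i} (-1)^{g(j)}`. -/
def jwSign (i : ℤ) (g : Config) : ℂ := ∏ j ∈ before i, if g j then -1 else 1

theorem norm_jwSign (i : ℤ) (g : Config) : ‖jwSign i g‖ = 1 := by
  unfold jwSign
  rw [norm_prod]
  refine Finset.prod_eq_one fun j _ => ?_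
  split_ifs <;> simp

/-- The coordinates of `a_i ψ`. -/
def annCoord (i : ℤ) (ψ : Config → ℂ) (g : Config) : ℂ :=
  if g i then 0 else jwSign i g * ψ (Function.update g i true)

theorem sum_annCoord_le (i : ℤ) (ψ : Hilb) (s : Finset Config) :
    ∑ g ∈ s, ‖annCoord i ψ g‖ ^ (2 : ENNReal).toReal ≤ ‖ψ‖ ^ (2 : ENNReal).toReal := by
  classical
  have h2 : 0 < (2 : ENNReal).toReal := by norm_num
  have hinj : Set.InjOn (fun g : Config => Function.update g i true)
      (s.filter fun g => g i = false) := by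
    intro g hg h hh e
    simp only [Finset.coe_filter, Set.mem_ofPred_eq] at hg hh
    funext j
    by_cases hj : j = i
    · subst hj; rw [hg.2, hh.2]
    · have := congrFun e j
      simpa [Function.update_of_ne hj] using this
  calc ∑ g ∈ s, ‖annCoord i ψ g‖ ^ (2 : ENNReal).toReal
      = ∑ g ∈ s.filter (fun g => g i = false),
          ‖ψ (Function.update g i true)‖ ^ (2 : ENNReal).toReal := by
        rw [Finset.sum_filter]
        refine Finset.sum_congr rfl fun g _ => ?_
        cases hg : g i <;> simp [annCoord, hg, norm_jwSign]
    _ = ∑ h ∈ (s.filter (fun g => g i = false)).image (fun g => Function.update g i true),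
          ‖ψ h‖ ^ (2 : ENNReal).toReal := by
        rw [Finset.sum_image hinj]
    _ ≤ ‖ψ‖ ^ (2 : ENNReal).toReal := lp.sum_rpow_le_norm_rpow h2 ψ _

/-- The annihilation operator of a fermion at the site `i`, as a bounded operator:
`a_i |g⟩ = 0` if `g(i) = 0`, and `a_i |g⟩ = ± |g'⟩` if `g(i) = 1`, where `g'` is `g` with the
site `i` emptied and `±` is the Jordan–Wigner sign. -/
def annOp (i : ℤ) : Hilb →L[ℂ] Hilb :=
  LinearMap.mkContinuous
    { toFun := fun ψ => ⟨annCoord i ψ, memℓp_gen' (sum_annCoord_le i ψ)⟩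
      map_add' := by
        intro ψ φ
        ext g
        simp only [annCoord, lp.coeFn_add, Pi.add_apply]
        split_ifs <;> ring
      map_smul' := by
        intro c ψ
        ext g
        simp only [annCoord, lp.coeFn_smul, Pi.smul_apply, smul_eq_mul, RingHom.id_apply]
        split_ifs <;> ring } 1 (by
    intro ψ
    rw [one_mul]
    exact lp.norm_le_of_forall_sum_le (by norm_num) (norm_nonneg _) (sum_annCoord_le i ψ))

/-! ### The CAR algebra, its local subalgebras and its states -/

/-- The CAR algebra over `ℤ`: the C*-algebra generated by the annihilation operators. -/
def carAlgebra : StarSubalgebra ℂ (Hilb →L[ℂ] Hilb) :=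
  (StarAlgebra.adjoin ℂ (Set.range annOp)).topologicalClosure

/-- The annihilation operator `a_i`, as an element of the CAR algebra. -/
def a (i : ℤ) : carAlgebra :=
  ⟨annOp i, StarSubalgebra.le_topologicalClosure _
    (StarAlgebra.subset_adjoin ℂ _ (Set.mem_range_self i))⟩

/-- The fermion number operator `n_i = a_i^* a_i`. -/
def num (i : ℤ) : carAlgebra := star (a i) * a i

/-- The local algebra `𝒜(I)`, generated by `a_i` and `a_i^*` for `i ∈ I`. -/
def localAlgebra (I : Finset ℤ) : StarSubalgebra ℂ carAlgebra :=
  StarAlgebra.adjoin ℂ (a '' (I : Set ℤ))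

/-- A state on the CAR algebra: a positive normalized linear functional. -/
@[ext]
structure CARState where
  toFun : carAlgebra →ₗ[ℂ] ℂ
  nonneg : ∀ A : carAlgebra, 0 ≤ toFun (star A * A)
  map_one : toFun 1 = 1

/-- The classical state `ψ_g`, `ψ_g(A) = ⟨g| A |g⟩`. -/
def classicalState (g : Config) : CARState where
  toFun :=
    { toFun := fun A => inner ℂ (ket g) ((A : Hilb →L[ℂ] Hilb) (ket g))
      map_add' := by
        intro A B
        simp
      map_smul' := by
        intro c A
        simp }
  nonneg := by
    intro A
    have h : inner ℂ (ket g)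
        (((star A * A : carAlgebra) : Hilb →L[ℂ] Hilb) (ket g))
        = ((‖(A : Hilb →L[ℂ] Hilb) (ket g)‖ : ℂ)) ^ 2 := by
      rw [MulMemClass.coe_mul, StarMemClass.coe_star, mul_apply_eq_comp,
        ContinuousLinearMap.star_eq_adjoint, ContinuousLinearMap.adjoint_inner_right,
        inner_self_eq_norm_sq_to_K]
      rfl
    change 0 ≤ inner ℂ (ket g) _
    rw [h]
    exact_mod_cast sq_nonneg ‖(A : Hilb →L[ℂ] Hilb) (ket g)‖
  map_one := by
    change inner ℂ (ket g) (((1 : carAlgebra) : Hilb →L[ℂ] Hilb) (ket g)) = 1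
    have h1 : ‖ket g‖ = 1 := by
      classical
      unfold ket
      rw [lp.norm_single (by norm_num), norm_one]
    simp [inner_self_eq_norm_sq_to_K, h1]

/-! ### The Nicolai model -/

/-- The local fermion charge `q({2i-1, 2i, 2i+1}) = a_{2i+1} a_{2i}^* a_{2i-1}`; the supercharge
`Q_Nic` is the formal sum of all of them. -/
def charge (i : ℤ) : carAlgebra := a (2 * i + 1) * star (a (2 * i)) * a (2 * i - 1)

/-- The fermion parity `(-1)^{F_I} = ∏_{j ∈ I} (1 - 2 n_j)` of the finite region `I`. -/
def parity (I : Finset ℤ) : carAlgebra :=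
  ((I.sort (· ≤ ·)).map fun j => 1 - 2 * num j).prod

/-- The grading automorphism `γ` (`a_j ↦ -a_j`) on the local algebra `𝒜(I)`, where it is
implemented by the parity of `I`. -/
def grading (I : Finset ℤ) (A : carAlgebra) : carAlgebra := parity I * A * parity I

/-- The superderivation `δ(A) = [Q_Nic, A]_γ = Q_Nic A - γ(A) Q_Nic` for `A ∈ 𝒜(I)`. By locality
only finitely many terms of the formal sum `Q_Nic` contribute. -/
def superDer (I : Finset ℤ) (A : carAlgebra) : carAlgebra :=
  ∑ᶠ i : ℤ, (charge i * A - grading I A * charge i)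

/-- The time generator `d(A) = [H_Nic, A]` for local `A`, where
`H_Nic = {Q_Nic, Q_Nic^*} = ∑_{i,j} {q_i, q_j^*}`. By locality only finitely many terms of the
formal sum `H_Nic` contribute. -/
def timeGen (A : carAlgebra) : carAlgebra :=
  ∑ᶠ p : ℤ × ℤ,
    ⁅charge p.1 * star (charge p.2) + star (charge p.2) * charge p.1, A⁆

/-- A state is supersymmetric if `φ(δ(A)) = 0` for every local `A`. -/
def IsSupersymmetric (φ : CARState) : Prop :=
  ∀ I : Finset ℤ, ∀ A ∈ localAlgebra I, φ.toFun (superDer I A) = 0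

/-- The graph of the generator of the time evolution of the Nicolai model: the closure of the
graph of `A ↦ [H_Nic, A]` on the local operators. -/
def generatorGraph : Set (carAlgebra × carAlgebra) :=
  closure {p | (∃ I : Finset ℤ, p.1 ∈ localAlgebra I) ∧ p.2 = timeGen p.1}

/-- A ground state for the time evolution of the Nicolai model: `φ(A^* d(A)) ≥ 0` for every `A`
in the domain of the generator. -/
def IsGroundState (φ : CARState) : Prop :=
  ∀ p ∈ generatorGraph, 0 ≤ φ.toFun (star p.1 * p.2)

/-- The set of all classical supersymmetric ground states of the Nicolai model. -/
def classicalSusyGroundStates : Set CARState :=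
  {φ | φ ∈ Set.range classicalState ∧ IsSupersymmetric φ ∧ IsGroundState φ}

/-! ### The classical spin model -/

/-- The occupation number `n_i ∈ {0, 1}` of a configuration. -/
def occ (g : Config) (i : ℤ) : ℝ := if g i then 1 else 0

/-- The local term `n_{2i} - n_{2i-1} n_{2i} - n_{2i} n_{2i+1} + n_{2i-1} n_{2i+1}` of
`H_classical`. -/
def localEnergy (i : ℤ) (g : Config) : ℝ :=
  occ g (2 * i) - occ g (2 * i - 1) * occ g (2 * i) - occ g (2 * i) * occ g (2 * i + 1)
    + occ g (2 * i - 1) * occ g (2 * i + 1)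

/-- `g` is a ground state of the classical spin model on the infinite lattice: no change of `g` at
finitely many sites lowers the energy `H_classical`. (The energy difference is a finite sum.) -/
def IsClassicalGround (g : Config) : Prop :=
  ∀ h : Config, {i : ℤ | h i ≠ g i}.Finite →
    0 ≤ ∑ᶠ i : ℤ, (localEnergy i h - localEnergy i g)

/-- The total energy `H_classical(g)`, as an extended real number. -/
def totalEnergy (g : Config) : EReal := ∑' i : ℤ, ((localEnergy i g : ℝ) : EReal)

/-- `g` is a global minimizer of the total energy `H_classical`. -/
def IsClassicalMinimizer (g : Config) : Prop :=
  ∀ h : Config, totalEnergy g ≤ totalEnergy h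

end

end Nicolai

namespace Nicolai

noncomputable section

open scoped ComplexOrder

/-! ### Ground states of the classical spin model -/

/-! Everything reduces to one condition: each local term of the classical energy vanishes. The term
at `i` is the indicator of the patterns 101 and 010 on the sites `2i-1, 2i, 2i+1`, and these are
exactly the patterns on which `q_i`, respectively `q_i^*`, does not annihilate `|g⟩`.

On the spin side, both notions of ground state mean zero local energies (`isClassicalGround_iff`,
`isClassicalMinimizer_iff`): the site `2i` enters only the `i`-th term, so that term can be relaxed
alone, and the empty configuration has total energy 0.

On the fermionic side, testing supersymmetry on `q_i^*` gives `‖q_i g‖² + ‖q_i^* g‖²`, which is the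
local energy (`classicalState_superDer_star_charge`); the cross terms vanish because distinct
charges flip distinct sets of sites. Conversely, if all `q_i` and `q_i^*` annihilate `|g⟩`, the
expectation of `δ(A)` vanishes term by term, and that of `A^*[H,A]` reduces to that of `A^*HA`, a
sum of two squares (`classicalState_timeGen_nonneg`); continuity extends this to the closure of the
generator.

The anticommutation relations and the grading serve locality: the formal sums are `finsum`s, which
can be manipulated only once their supports are known to be finite. -/

theorem localEnergy_eq (i : ℤ) (g : Config) :
    localEnergy i g =
      if g (2 * i - 1) = g (2 * i + 1) ∧ g (2 * i) ≠ g (2 * i - 1) then 1 else 0 := by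
  unfold localEnergy occ
  cases g (2 * i - 1) <;> cases g (2 * i) <;> cases g (2 * i + 1) <;> simp

theorem localEnergy_nonneg (i : ℤ) (g : Config) : 0 ≤ localEnergy i g := by
  rw [localEnergy_eq]
  split_ifs <;> simp

/-- Neighbouring triples share only odd sites, so an even site belongs to a single triple. -/
theorem localEnergy_update_even (i j : ℤ) (hij : j ≠ i) (g : Config) (b : Bool) :
    localEnergy j (Function.update g (2 * i) b) = localEnergy j g := by
  unfold localEnergy occ
  rw [Function.update_of_ne (by omega), Function.update_of_ne (by omega),
    Function.update_of_ne (by omega)]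

theorem localEnergy_update_self (i : ℤ) (g : Config) :
    localEnergy i (Function.update g (2 * i) (g (2 * i - 1))) = 0 := by
  rw [localEnergy_eq, if_neg]
  rw [Function.update_self, Function.update_of_ne (by omega : 2 * i - 1 ≠ 2 * i)]
  simp

theorem isClassicalGround_iff (g : Config) :
    IsClassicalGround g ↔ ∀ i, localEnergy i g = 0 := by
  constructor
  · intro hg i
    have hfin : {k : ℤ | Function.update g (2 * i) (g (2 * i - 1)) k ≠ g k}.Finite := by
      refine (Set.finite_singleton (2 * i)).subset fun k hk => ?_
      by_contra hne
      exact hk (Function.update_of_ne hne _ _)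
    have h := hg _ hfin
    rw [finsum_eq_single _ i fun j hj => by rw [localEnergy_update_even i j hj, sub_self],
      localEnergy_update_self] at h
    linarith [localEnergy_nonneg i g]
  · intro hg h _
    exact finsum_nonneg fun i => by rw [hg i, sub_zero]; exact localEnergy_nonneg i h

theorem localEnergy_le_totalEnergy (i : ℤ) (g : Config) :
    ((localEnergy i g : ℝ) : EReal) ≤ totalEnergy g := by
  have hnn : ∀ j, (0 : EReal) ≤ ((localEnergy j g : ℝ) : EReal) := fun j =>
    EReal.coe_nonneg.2 (localEnergy_nonneg j g)
  -- A nonnegative family in `EReal` sums to the supremum of its finite partial sums, so the `tsum`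
  -- is a genuine sum and not a default value.
  have hs : HasSum (fun j => ((localEnergy j g : ℝ) : EReal))
      (⨆ s : Finset ℤ, ∑ j ∈ s, ((localEnergy j g : ℝ) : EReal)) :=
    hasSum_of_isLUB_of_nonneg _ hnn isLUB_iSup
  rw [totalEnergy, hs.tsum_eq]
  exact (by simp : ((localEnergy i g : ℝ) : EReal) = ∑ j ∈ {i}, ((localEnergy j g : ℝ) : EReal)).le.trans
    (le_iSup (fun s : Finset ℤ => ∑ j ∈ s, ((localEnergy j g : ℝ) : EReal)) {i})

theorem totalEnergy_eq_zero {g : Config} (hg : ∀ i, localEnergy i g = 0) :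
    totalEnergy g = 0 := by
  simp [totalEnergy, hg]

theorem isClassicalMinimizer_iff (g : Config) :
    IsClassicalMinimizer g ↔ ∀ i, localEnergy i g = 0 := by
  constructor
  · intro hg i
    have h0 : totalEnergy (fun _ => false) = 0 :=
      totalEnergy_eq_zero fun i => by simp [localEnergy_eq]
    have h := (localEnergy_le_totalEnergy i g).trans ((hg _).trans h0.le)
    exact le_antisymm (EReal.coe_nonpos.1 h) (localEnergy_nonneg i g)
  · intro hg h
    rw [totalEnergy_eq_zero hg]
    exact (EReal.coe_nonneg.2 (localEnergy_nonneg 0 h)).trans (localEnergy_le_totalEnergy 0 h)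

/-! ### The annihilation operators on product vectors -/

theorem ket_apply (g h : Config) [Decidable (h = g)] : ket g h = if h = g then 1 else 0 := by
  classical
  unfold ket
  split_ifs with e
  · subst e; simp
  · rw [lp.single_apply_ne _ _ _ e]

theorem inner_ket_left (g : Config) (ψ : Hilb) : inner ℂ (ket g) ψ = ψ g := by
  classical
  unfold ket
  rw [lp.inner_single_left]
  simp

theorem inner_ket_ket (g h : Config) [Decidable (g = h)] :
    inner ℂ (ket g) (ket h) = if g = h then (1 : ℂ) else 0 := by
  rw [inner_ket_left, ket_apply]

theorem norm_ket (g : Config) : ‖ket g‖ = 1 := by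
  classical
  unfold ket
  rw [lp.norm_single (by norm_num), norm_one]

/-- The coordinate of `A^* ψ` at `g` is `⟨A g, ψ⟩`; comparing adjoints thus replaces a density
argument. -/
theorem clm_ext_ket {A B : Hilb →L[ℂ] Hilb} (h : ∀ g, A (ket g) = B (ket g)) : A = B := by
  apply star_injective
  ext ψ g
  rw [← inner_ket_left, ← inner_ket_left, ContinuousLinearMap.star_eq_adjoint,
    ContinuousLinearMap.star_eq_adjoint, ContinuousLinearMap.adjoint_inner_right,
    ContinuousLinearMap.adjoint_inner_right, h]

theorem self_notMem_before (i : ℤ) : i ∉ before i := by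
  unfold before
  split_ifs <;> simp

/-- Of two distinct sites exactly one precedes the other; this is the origin of the minus sign in
the anticommutation relations. -/
theorem mem_before_iff {i j : ℤ} (h : i ≠ j) : i ∈ before j ↔ j ∉ before i := by
  unfold before
  split_ifs <;> simp only [Finset.mem_Ico, Finset.mem_Ioo] <;> omega

theorem jwSign_update_of_notMem {i j : ℤ} (h : j ∉ before i) (g : Config) (b : Bool) :
    jwSign i (Function.update g j b) = jwSign i g := by
  unfold jwSign
  refine Finset.prod_congr rfl fun k hk => ?_
  rw [Function.update_of_ne (by rintro rfl; exact h hk)]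

theorem jwSign_update_of_mem {i j : ℤ} (h : j ∈ before i) (g : Config) :
    jwSign i (Function.update g j (!g j)) = -jwSign i g := by
  unfold jwSign
  rw [← Finset.mul_prod_erase _ _ h, ← Finset.mul_prod_erase _ _ h,
    Finset.prod_congr rfl fun k hk => by
      rw [Function.update_of_ne (Finset.ne_of_mem_erase hk)]]
  cases hg : g j <;> simp

/-- Flipping the site `j` changes exactly one of the signs of `i` and `j`. -/
theorem jwSign_flip_mul {i j : ℤ} (h : i ≠ j) (g : Config) :
    jwSign i g * jwSign j (Function.update g i (!g i)) =
      -(jwSign j g * jwSign i (Function.update g j (!g j))) := by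
  by_cases hi : i ∈ before j
  · rw [jwSign_update_of_mem hi, jwSign_update_of_notMem ((mem_before_iff h).1 hi)]
    ring
  · have hj : j ∈ before i := (mem_before_iff h.symm).2 hi
    rw [jwSign_update_of_mem hj, jwSign_update_of_notMem hi]
    ring

theorem conj_jwSign (i : ℤ) (g : Config) : (starRingEnd ℂ) (jwSign i g) = jwSign i g := by
  unfold jwSign
  rw [map_prod]
  refine Finset.prod_congr rfl fun j _ => ?_
  split_ifs <;> simp

theorem jwSign_mul_self (i : ℤ) (g : Config) : jwSign i g * jwSign i g = 1 := by
  unfold jwSign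
  rw [← Finset.prod_mul_distrib]
  refine Finset.prod_eq_one fun j _ => ?_
  split_ifs <;> simp

theorem annOp_apply (i : ℤ) (ψ : Hilb) (g : Config) :
    annOp i ψ g = if g i then 0 else jwSign i g * ψ (Function.update g i true) := rfl

theorem eq_update_not_iff (g h : Config) (i : ℤ) :
    h = Function.update g i (!g i) ↔ g = Function.update h i (!h i) := by
  constructor <;> rintro rfl <;> simp

theorem annOp_ket (i : ℤ) (g : Config) :
    annOp i (ket g) = if g i then jwSign i g • ket (Function.update g i (!g i)) else 0 := by
  classical
  ext h
  rw [annOp_apply, ket_apply]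
  by_cases e : h = Function.update g i (!g i)
  · subst e
    cases hg : g i
    · simp
    · have hu : Function.update g i true = g := by rw [← hg, Function.update_eq_self]
      simp [ket_apply, jwSign_update_of_notMem (self_notMem_before i), hu]
  · have hr : (if g i then jwSign i g • ket (Function.update g i (!g i)) else 0) h = 0 := by
      split_ifs <;> simp [ket_apply, e]
    rw [hr]
    cases hh : h i
    · have : ¬ Function.update h i true = g := by
        intro e'
        apply e
        rw [eq_update_not_iff, hh]
        exact e'.symm
      simp [this]
    · simp

theorem star_annOp_ket (i : ℤ) (g : Config) :
    star (annOp i) (ket g) =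
      if g i then 0 else jwSign i g • ket (Function.update g i (!g i)) := by
  classical
  ext h
  rw [← inner_ket_left, ContinuousLinearMap.star_eq_adjoint,
    ContinuousLinearMap.adjoint_inner_right, annOp_ket]
  by_cases e : g = Function.update h i (!h i)
  · subst e
    cases hh : h i
    · simp
    · have hu : Function.update h i true = h := by rw [← hh, Function.update_eq_self]
      simp [hu, inner_smul_left, norm_ket, conj_jwSign, ket_apply,
        jwSign_update_of_notMem (self_notMem_before i)]
  · have e' : ¬ h = Function.update g i (!g i) := fun e' => e ((eq_update_not_iff g h i).1 e')
    have e2 : ¬ Function.update h i (!h i) = g := fun e' => e e'.symm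
    split_ifs <;> simp [inner_smul_left, inner_ket_ket, ket_apply, e', e2]

/-! ### The canonical anticommutation relations -/

theorem update_flip_comm {i j : ℤ} (h : i ≠ j) (g : Config) :
    Function.update (Function.update g i (!g i)) j (!g j) =
      Function.update (Function.update g j (!g j)) i (!g i) :=
  Function.update_comm h _ _ _

theorem annOp_anticomm (i j : ℤ) : annOp i * annOp j = -(annOp j * annOp i) := by
  refine clm_ext_ket fun g => ?_
  simp only [neg_apply, mul_apply_eq_comp, annOp_ket, apply_ite, map_smul, map_zero]
  by_cases h : i = j
  · subst h
    cases hg : g i <;> simp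
  · have h' : j ≠ i := fun e => h e.symm
    cases hi : g i <;> cases hj : g j <;>
      simp [hi, hj, Function.update_of_ne h, Function.update_of_ne h']
    -- Only the case of two occupied sites is left: both orders reach the same product vector, with
    -- opposite signs.
    have := jwSign_flip_mul h g
    have hc := update_flip_comm h g
    rw [hi, hj] at *
    simp only [Bool.not_true] at *
    rw [smul_smul, smul_smul, this, hc, neg_smul, neg_neg]

theorem annOp_anticomm_star {i j : ℤ} (h : i ≠ j) :
    annOp i * star (annOp j) = -(star (annOp j) * annOp i) := by
  refine clm_ext_ket fun g => ?_
  have h' : j ≠ i := fun e => h e.symm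
  cases hi : g i <;> cases hj : g j <;>
    simp [hi, hj, annOp_ket, star_annOp_ket, Function.update_of_ne h, Function.update_of_ne h']
  have := jwSign_flip_mul h g
  have hc := update_flip_comm h g
  rw [hi, hj] at *
  simp only [Bool.not_true, Bool.not_false] at *
  rw [smul_smul, smul_smul, this, hc, neg_smul, neg_neg]

theorem annOp_mul_star_add (i : ℤ) :
    annOp i * star (annOp i) + star (annOp i) * annOp i = 1 := by
  refine clm_ext_ket fun g => ?_
  have hs : jwSign i g • jwSign i g • ket g = ket g := by
    rw [smul_smul, jwSign_mul_self, one_smul]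
  cases hi : g i
  · have hu : Function.update g i false = g := by rw [← hi, Function.update_eq_self]
    simp [hi, annOp_ket, star_annOp_ket, jwSign_update_of_notMem (self_notMem_before i), hu, hs]
  · have hu : Function.update g i true = g := by rw [← hi, Function.update_eq_self]
    simp [hi, annOp_ket, star_annOp_ket, jwSign_update_of_notMem (self_notMem_before i), hu, hs]

theorem coe_a (i : ℤ) : ((a i : carAlgebra) : Hilb →L[ℂ] Hilb) = annOp i := rfl

theorem a_anticomm (i j : ℤ) : a i * a j = -(a j * a i) :=
  Subtype.ext (annOp_anticomm i j)

theorem a_anticomm_star {i j : ℤ} (h : i ≠ j) : a i * star (a j) = -(star (a j) * a i) :=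
  Subtype.ext (annOp_anticomm_star h)

theorem star_a_anticomm (i j : ℤ) : star (a i) * star (a j) = -(star (a j) * star (a i)) := by
  rw [← star_mul, ← star_mul, ← star_neg, a_anticomm]

theorem star_a_anticomm_a {i j : ℤ} (h : i ≠ j) : star (a i) * a j = -(a j * star (a i)) := by
  rw [a_anticomm_star h.symm, neg_neg]

theorem a_mul_star_add (i : ℤ) : a i * star (a i) + star (a i) * a i = 1 :=
  Subtype.ext (annOp_mul_star_add i)

theorem a_mul_self (i : ℤ) : a i * a i = 0 := by
  have h : a i * a i = (2⁻¹ : ℂ) • (a i * a i - -(a i * a i)) := by module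
  rw [h, ← a_anticomm, sub_self, smul_zero]

/-! ### The fermion parity and the grading -/

theorem star_num (i : ℤ) : star (num i) = num i := by
  simp [num]

theorem star_one_sub_num (i : ℤ) : star (1 - 2 * num i) = 1 - 2 * num i := by
  simp only [two_mul, star_sub, star_add, star_one, star_num]

theorem num_mul_a (i : ℤ) : num i * a i = 0 := by
  rw [num, mul_assoc, a_mul_self, mul_zero]

theorem a_mul_num (i : ℤ) : a i * num i = a i := by
  have h := congrArg (· * a i) (a_mul_star_add i)
  simp only [add_mul, one_mul] at h
  rw [mul_assoc, mul_assoc, a_mul_self, mul_zero, add_zero] at h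
  exact h

theorem num_mul_self (i : ℤ) : num i * num i = num i := by
  conv_lhs => rw [num, mul_assoc]
  rw [← num, a_mul_num, num]

theorem one_sub_num_sq (i : ℤ) : (1 - 2 * num i) * (1 - 2 * num i) = 1 := by
  have h := num_mul_self i
  simp only [two_mul, sub_mul, mul_sub, add_mul, mul_add, one_mul, mul_one, h]
  abel

theorem one_sub_num_mul_a (i : ℤ) : (1 - 2 * num i) * a i = -(a i * (1 - 2 * num i)) := by
  simp only [two_mul, sub_mul, mul_sub, add_mul, mul_add, one_mul, mul_one, num_mul_a, a_mul_num]
  abel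

theorem one_sub_num_commute_a {i j : ℤ} (h : i ≠ j) :
    (1 - 2 * num i) * a j = a j * (1 - 2 * num i) := by
  have hn : num i * a j = a j * num i := by
    rw [num, mul_assoc, a_anticomm i j, mul_neg, ← mul_assoc, star_a_anticomm_a h, neg_mul,
      neg_neg, mul_assoc]
  simp only [two_mul, sub_mul, mul_sub, add_mul, mul_add, one_mul, mul_one, hn]

theorem one_sub_num_mul_star_a (i : ℤ) :
    (1 - 2 * num i) * star (a i) = -(star (a i) * (1 - 2 * num i)) := by
  have h := congrArg star (one_sub_num_mul_a i)
  rw [star_neg, star_mul, star_mul, star_one_sub_num] at h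
  rw [h, neg_neg]

theorem one_sub_num_commute_star_a {i j : ℤ} (h : i ≠ j) :
    (1 - 2 * num i) * star (a j) = star (a j) * (1 - 2 * num i) := by
  have h := congrArg star (one_sub_num_commute_a h)
  rw [star_mul, star_mul, star_one_sub_num] at h
  exact h.symm

theorem one_sub_num_commute (i j : ℤ) : Commute (1 - 2 * num i) (1 - 2 * num j) := by
  by_cases h : i = j
  · rw [h]
  · have hn : Commute (1 - 2 * num i) (num j) :=
      Commute.mul_right (one_sub_num_commute_star_a h) (one_sub_num_commute_a h)
    rw [two_mul (num j)]
    exact (Commute.one_right _).sub_right (hn.add_right hn)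

theorem list_parity_commute (l : List ℤ) (x : carAlgebra)
    (hx : ∀ j ∈ l, (1 - 2 * num j) * x = x * (1 - 2 * num j)) :
    (l.map fun j => 1 - 2 * num j).prod * x = x * (l.map fun j => 1 - 2 * num j).prod := by
  induction l with
  | nil => simp
  | cons k l ih =>
    simp only [List.map_cons, List.prod_cons]
    rw [mul_assoc, ih fun j hj => hx j (List.mem_cons_of_mem _ hj), ← mul_assoc,
      hx k List.mem_cons_self, mul_assoc]

theorem list_parity_sq (l : List ℤ) :
    (l.map fun j => 1 - 2 * num j).prod * (l.map fun j => 1 - 2 * num j).prod = 1 := by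
  induction l with
  | nil => simp
  | cons k l ih =>
    simp only [List.map_cons, List.prod_cons]
    rw [mul_assoc, ← mul_assoc _ (1 - 2 * num k),
      list_parity_commute l _ fun j _ => one_sub_num_commute j k, mul_assoc, ih, mul_one,
      one_sub_num_sq]

/-- Exactly one factor of the parity, the one at `k`, changes the sign of `x`; `Nodup` ensures that
it occurs once. -/
theorem list_parity_anticomm (l : List ℤ) (hl : l.Nodup) (k : ℤ) (hk : k ∈ l) (x : carAlgebra)
    (hkx : (1 - 2 * num k) * x = -(x * (1 - 2 * num k)))
    (hx : ∀ j, j ≠ k → (1 - 2 * num j) * x = x * (1 - 2 * num j)) :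
    (l.map fun j => 1 - 2 * num j).prod * x = -(x * (l.map fun j => 1 - 2 * num j).prod) := by
  induction l with
  | nil => simp at hk
  | cons m l ih =>
    simp only [List.map_cons, List.prod_cons]
    rw [List.nodup_cons] at hl
    by_cases h : m = k
    · subst h
      rw [mul_assoc, list_parity_commute l x fun j hj => hx j (by rintro rfl; exact hl.1 hj),
        ← mul_assoc, hkx, neg_mul, mul_assoc]
    · rw [mul_assoc, ih hl.2 ((List.mem_cons.1 hk).resolve_left (Ne.symm h)), mul_neg,
        ← mul_assoc, hx m h, mul_assoc]

theorem parity_sq (I : Finset ℤ) : parity I * parity I = 1 := list_parity_sq _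

theorem grading_add (I : Finset ℤ) (A B : carAlgebra) :
    grading I (A + B) = grading I A + grading I B := by
  simp only [grading, mul_add, add_mul]

theorem grading_mul (I : Finset ℤ) (A B : carAlgebra) :
    grading I (A * B) = grading I A * grading I B := by
  simp only [grading]
  rw [show parity I * A * parity I * (parity I * B * parity I)
    = parity I * A * (parity I * parity I) * (B * parity I) by simp only [mul_assoc], parity_sq]
  simp only [mul_one, mul_assoc]

theorem grading_grading (I : Finset ℤ) (A : carAlgebra) : grading I (grading I A) = A := by
  simp only [grading]
  rw [show parity I * (parity I * A * parity I) * parity I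
    = parity I * parity I * A * (parity I * parity I) by simp only [mul_assoc], parity_sq,
    one_mul, mul_one]

theorem grading_algebraMap (I : Finset ℤ) (c : ℂ) :
    grading I (algebraMap ℂ carAlgebra c) = algebraMap ℂ carAlgebra c := by
  rw [grading, ← Algebra.commutes, mul_assoc, parity_sq, mul_one]

theorem grading_a {I : Finset ℤ} {k : ℤ} (hk : k ∈ I) : grading I (a k) = -a k := by
  rw [grading, parity, list_parity_anticomm _ (I.sort_nodup (· ≤ ·)) k (by simpa using hk) _
    (one_sub_num_mul_a k) fun j hj => one_sub_num_commute_a hj, ← parity, neg_mul, mul_assoc,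
    parity_sq, mul_one]

theorem grading_star_a {I : Finset ℤ} {k : ℤ} (hk : k ∈ I) :
    grading I (star (a k)) = -star (a k) := by
  rw [grading, parity, list_parity_anticomm _ (I.sort_nodup (· ≤ ·)) k (by simpa using hk) _
    (one_sub_num_mul_star_a k) fun j hj => one_sub_num_commute_star_a hj, ← parity, neg_mul,
    mul_assoc, parity_sq, mul_one]

theorem a_mem_localAlgebra {I : Finset ℤ} {k : ℤ} (hk : k ∈ I) : a k ∈ localAlgebra I :=
  StarAlgebra.subset_adjoin ℂ _ ⟨k, hk, rfl⟩

theorem parity_mem_localAlgebra (I : Finset ℤ) : parity I ∈ localAlgebra I := by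
  refine list_prod_mem fun x hx => ?_
  obtain ⟨k, hk, rfl⟩ := List.mem_map.1 hx
  have hk' := a_mem_localAlgebra ((Finset.mem_sort _).1 hk)
  have hn : num k ∈ localAlgebra I := mul_mem (star_mem hk') hk'
  rw [two_mul]
  exact sub_mem (one_mem _) (add_mem hn hn)

theorem grading_mem_localAlgebra {I : Finset ℤ} {A : carAlgebra} (hA : A ∈ localAlgebra I) :
    grading I A ∈ localAlgebra I :=
  mul_mem (mul_mem (parity_mem_localAlgebra I) hA) (parity_mem_localAlgebra I)

/-! ### Locality -/

/-- An element that anticommutes with the generators of a local algebra commutes with the whole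
local algebra in the graded sense. -/
theorem mul_eq_grading_mul {I : Finset ℤ} {c : carAlgebra}
    (hc : ∀ k ∈ I, c * a k = -(a k * c) ∧ c * star (a k) = -(star (a k) * c))
    {A : carAlgebra} (hA : A ∈ localAlgebra I) : c * A = grading I A * c := by
  -- With the adjoints among the generators, the induction has no case for `star`.
  have key : ∀ B ∈ Algebra.adjoin ℂ (a '' (I : Set ℤ) ∪ star (a '' (I : Set ℤ))),
      c * B = grading I B * c := by
    intro B hB
    induction hB using Algebra.adjoin_induction with
    | mem x hx =>
      rcases hx with ⟨k, hk, rfl⟩ | ⟨k, hk, hkx⟩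
      · rw [grading_a hk, (hc k hk).1, neg_mul]
      · obtain rfl : x = star (a k) := by rw [hkx, star_star]
        rw [grading_star_a hk, (hc k hk).2, neg_mul]
    | algebraMap r => rw [grading_algebraMap, Algebra.commutes]
    | add x y _ _ hx hy => rw [grading_add, mul_add, add_mul, hx, hy]
    | mul x y _ _ hx hy => rw [grading_mul, ← mul_assoc, hx, mul_assoc, hy, mul_assoc]
  refine key A ?_
  rw [← StarAlgebra.adjoin_toSubalgebra]
  exact hA

theorem mul_anticomm_of_anticomm {R : Type*} [Ring R] {x y z k : R} (hx : x * k = -(k * x))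
    (hy : y * k = -(k * y)) (hz : z * k = -(k * z)) : x * y * z * k = -(k * (x * y * z)) := by
  rw [mul_assoc, hz, mul_neg, ← mul_assoc, mul_assoc x, hy, mul_neg, ← mul_assoc, hx]
  simp only [neg_mul, neg_neg, mul_assoc]

theorem star_charge (i : ℤ) :
    star (charge i) = star (a (2 * i - 1)) * a (2 * i) * star (a (2 * i + 1)) := by
  simp only [charge, star_mul, star_star, mul_assoc]

theorem charge_anticomm {i k : ℤ} (h : ¬(2 * i - 1 ≤ k ∧ k ≤ 2 * i + 1)) :
    charge i * a k = -(a k * charge i) ∧ charge i * star (a k) = -(star (a k) * charge i) :=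
  ⟨mul_anticomm_of_anticomm (a_anticomm _ _) (star_a_anticomm_a (by omega)) (a_anticomm _ _),
    mul_anticomm_of_anticomm (a_anticomm_star (by omega)) (star_a_anticomm _ _)
      (a_anticomm_star (by omega))⟩

theorem star_charge_anticomm {i k : ℤ} (h : ¬(2 * i - 1 ≤ k ∧ k ≤ 2 * i + 1)) :
    star (charge i) * a k = -(a k * star (charge i)) ∧
      star (charge i) * star (a k) = -(star (a k) * star (charge i)) := by
  rw [star_charge]
  exact ⟨mul_anticomm_of_anticomm (star_a_anticomm_a (by omega)) (a_anticomm _ _)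
      (star_a_anticomm_a (by omega)),
    mul_anticomm_of_anticomm (star_a_anticomm _ _) (a_anticomm_star (by omega))
      (star_a_anticomm _ _)⟩

/-- Neighbouring charges share an odd site; from index distance 2 on the supports are disjoint, and
odd elements with disjoint supports anticommute. -/
theorem charge_anticomm_star_charge {i j : ℤ} (h : i + 1 < j ∨ j + 1 < i) :
    charge i * star (charge j) = -(star (charge j) * charge i) := by
  have h1 := (charge_anticomm (i := i) (k := 2 * j - 1) (by omega)).2
  have h2 := (charge_anticomm (i := i) (k := 2 * j) (by omega)).1
  have h3 := (charge_anticomm (i := i) (k := 2 * j + 1) (by omega)).2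
  have neg_flip : ∀ {x y : carAlgebra}, x * y = -(y * x) → y * x = -(x * y) :=
    fun h => by rw [h, neg_neg]
  rw [star_charge]
  exact neg_flip (mul_anticomm_of_anticomm (neg_flip h1) (neg_flip h2) (neg_flip h3))

/-- The sites of a charge. -/
def sites (i : ℤ) : Finset ℤ := Finset.Icc (2 * i - 1) (2 * i + 1)

theorem star_charge_mem_localAlgebra (i : ℤ) : star (charge i) ∈ localAlgebra (sites i) := by
  have h : ∀ k, 2 * i - 1 ≤ k ∧ k ≤ 2 * i + 1 → a k ∈ localAlgebra (sites i) :=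
    fun k hk => a_mem_localAlgebra (Finset.mem_Icc.2 hk)
  rw [star_charge]
  exact mul_mem (mul_mem (star_mem (h _ (by omega))) (h _ (by omega))) (star_mem (h _ (by omega)))

theorem grading_star_charge (i : ℤ) : grading (sites i) (star (charge i)) = -star (charge i) := by
  have h : ∀ k, 2 * i - 1 ≤ k ∧ k ≤ 2 * i + 1 → k ∈ sites i := fun k hk => Finset.mem_Icc.2 hk
  rw [star_charge, grading_mul, grading_mul, grading_star_a (h _ (by omega)),
    grading_a (h _ (by omega)), grading_star_a (h _ (by omega))]
  simp only [neg_mul, mul_neg, neg_neg]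

theorem exists_bound (I : Finset ℤ) : ∃ M : ℤ, ∀ k ∈ I, -M ≤ k ∧ k ≤ M := by
  refine ⟨∑ k ∈ I, |k|, fun k hk => abs_le.1 ?_⟩
  exact Finset.single_le_sum (f := fun k : ℤ => |k|) (fun j _ => abs_nonneg j) hk

/-- Only finitely many charges contribute to the superderivation of a local operator. -/
theorem superDer_support_finite {I : Finset ℤ} {A : carAlgebra} (hA : A ∈ localAlgebra I) :
    (Function.support fun i => charge i * A - grading I A * charge i).Finite := by
  obtain ⟨M, hM⟩ := exists_bound I
  refine (Set.finite_Icc (-M - 1) (M + 1)).subset fun i hi => ?_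
  by_contra hmem
  rw [Set.mem_Icc] at hmem
  refine hi (sub_eq_zero.2 (mul_eq_grading_mul (fun k hk => charge_anticomm ?_) hA))
  have := hM k hk
  omega

/-- Only finitely many terms of the Hamiltonian contribute to the time derivative of a local
operator. -/
theorem timeGen_support_finite {I : Finset ℤ} {A : carAlgebra} (hA : A ∈ localAlgebra I) :
    (Function.support fun p : ℤ × ℤ =>
      ⁅charge p.1 * star (charge p.2) + star (charge p.2) * charge p.1, A⁆).Finite := by
  obtain ⟨M, hM⟩ := exists_bound I
  refine ((Set.finite_Icc (-M - 2) (M + 2)).prod (Set.finite_Icc (-M - 2) (M + 2))).subset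
    fun p hp => ?_
  obtain ⟨i, j⟩ := p
  by_contra hmem
  rw [Set.mem_prod, Set.mem_Icc, Set.mem_Icc] at hmem
  apply hp
  simp only at hmem ⊢
  -- Distant charges have zero anticommutator. Otherwise the indices differ by at most 1, so the
  -- margin 2 puts both charges off `I`; moving `A` past both applies the grading twice, which is
  -- the identity.
  by_cases h : i + 1 < j ∨ j + 1 < i
  · rw [charge_anticomm_star_charge h, neg_add_cancel, Ring.lie_def, zero_mul, mul_zero, sub_zero]
  · have hc : ∀ B ∈ localAlgebra I, charge i * B = grading I B * charge i := fun B =>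
      mul_eq_grading_mul fun k hk => charge_anticomm (by have := hM k hk; omega)
    have hd : ∀ B ∈ localAlgebra I, star (charge j) * B = grading I B * star (charge j) := fun B =>
      mul_eq_grading_mul fun k hk => star_charge_anticomm (by have := hM k hk; omega)
    have hA' := grading_mem_localAlgebra hA
    rw [Ring.lie_def, sub_eq_zero, add_mul, mul_add, mul_assoc, hd A hA, ← mul_assoc,
      hc _ hA', grading_grading, mul_assoc _ _ A, hc A hA, ← mul_assoc, hd _ hA',
      grading_grading, mul_assoc, mul_assoc]

/-! ### The charges on product vectors -/

/-- The configuration with the three sites of the `i`-th charge flipped. -/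
def flip (i : ℤ) (g : Config) : Config := fun k => if k ∈ sites i then !g k else g k

theorem flip_injective {i j : ℤ} {g : Config} (h : flip i g = flip j g) : i = j := by
  -- The middle site `2i` lies in no triple but the `i`-th.
  have h' := congrFun h (2 * i)
  simp only [flip, sites, Finset.mem_Icc] at h'
  rw [if_pos (by omega)] at h'
  by_contra hne
  rw [if_neg (by omega)] at h'
  simp at h'

theorem update_three (i : ℤ) (g : Config) :
    Function.update (Function.update (Function.update g (2 * i - 1) (!g (2 * i - 1)))
      (2 * i) (!g (2 * i))) (2 * i + 1) (!g (2 * i + 1)) = flip i g := by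
  funext k
  simp only [flip, sites, Finset.mem_Icc, Function.update_apply]
  split_ifs <;> first | omega | simp_all

theorem update_three' (i : ℤ) (g : Config) :
    Function.update (Function.update (Function.update g (2 * i + 1) (!g (2 * i + 1)))
      (2 * i) (!g (2 * i))) (2 * i - 1) (!g (2 * i - 1)) = flip i g := by
  funext k
  simp only [flip, sites, Finset.mem_Icc, Function.update_apply]
  split_ifs <;> first | omega | simp_all

/-- The charge maps a product vector to zero or to another product vector, up to a phase. -/
theorem charge_ket (i : ℤ) (g : Config) : ∃ c : ℂ, ‖c‖ = 1 ∧
    (charge i : Hilb →L[ℂ] Hilb) (ket g) =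
      if g (2 * i - 1) = true ∧ g (2 * i) = false ∧ g (2 * i + 1) = true
      then c • ket (flip i g) else 0 := by
  -- The phase collects the Jordan–Wigner signs as the rightmost factor acts first; the adjoint
  -- charge acts in the opposite order, whence `update_three'`.
  refine ⟨jwSign (2 * i - 1) g * (jwSign (2 * i) (Function.update g (2 * i - 1) (!g (2 * i - 1))) *
    jwSign (2 * i + 1) (Function.update (Function.update g (2 * i - 1) (!g (2 * i - 1)))
      (2 * i) (!g (2 * i)))), by simp [norm_jwSign], ?_⟩
  have h1 : 2 * i ≠ 2 * i - 1 := by omega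
  have h2 : 2 * i + 1 ≠ 2 * i - 1 := by omega
  have h3 : 2 * i + 1 ≠ 2 * i := by omega
  simp only [charge, MulMemClass.coe_mul, StarMemClass.coe_star, coe_a, mul_apply_eq_comp]
  rw [← update_three]
  cases ha : g (2 * i - 1) <;> cases hb : g (2 * i) <;> cases hc : g (2 * i + 1) <;>
    simp [annOp_ket, star_annOp_ket, ha, hb, hc, Function.update_of_ne, h1, h2, h3, smul_smul,
      mul_assoc]

theorem star_charge_ket (i : ℤ) (g : Config) : ∃ c : ℂ, ‖c‖ = 1 ∧
    (star (charge i) : Hilb →L[ℂ] Hilb) (ket g) =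
      if g (2 * i - 1) = false ∧ g (2 * i) = true ∧ g (2 * i + 1) = false
      then c • ket (flip i g) else 0 := by
  refine ⟨jwSign (2 * i + 1) g * (jwSign (2 * i) (Function.update g (2 * i + 1) (!g (2 * i + 1))) *
    jwSign (2 * i - 1) (Function.update (Function.update g (2 * i + 1) (!g (2 * i + 1)))
      (2 * i) (!g (2 * i)))), by simp [norm_jwSign], ?_⟩
  have h1 : 2 * i ≠ 2 * i + 1 := by omega
  have h2 : 2 * i - 1 ≠ 2 * i + 1 := by omega
  have h3 : 2 * i - 1 ≠ 2 * i := by omega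
  rw [← StarMemClass.coe_star, star_charge]
  simp only [MulMemClass.coe_mul, StarMemClass.coe_star, coe_a, mul_apply_eq_comp]
  rw [← update_three']
  cases ha : g (2 * i - 1) <;> cases hb : g (2 * i) <;> cases hc : g (2 * i + 1) <;>
    simp [annOp_ket, star_annOp_ket, ha, hb, hc, Function.update_of_ne, h1, h2, h3, smul_smul,
      mul_assoc]

/-! ### Classical states -/

theorem classicalState_apply (g : Config) (A : carAlgebra) :
    (classicalState g).toFun A = inner ℂ (ket g) ((A : Hilb →L[ℂ] Hilb) (ket g)) := rfl

theorem classicalState_mul (g : Config) (A B : carAlgebra) :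
    (classicalState g).toFun (A * B) =
      inner ℂ ((star A : Hilb →L[ℂ] Hilb) (ket g)) ((B : Hilb →L[ℂ] Hilb) (ket g)) := by
  rw [classicalState_apply, MulMemClass.coe_mul, mul_apply_eq_comp,
    ContinuousLinearMap.star_eq_adjoint, ContinuousLinearMap.adjoint_inner_left]

theorem classicalState_num (g : Config) (i : ℤ) :
    (classicalState g).toFun (num i) = if g i then 1 else 0 := by
  rw [num, classicalState_mul, ← StarMemClass.coe_star, star_star, coe_a, annOp_ket]
  split_ifs
  · rw [inner_self_eq_norm_sq_to_K, norm_smul, norm_jwSign, norm_ket]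
    simp
  · simp

theorem classicalState_injective : Function.Injective classicalState := by
  intro g h e
  funext i
  have h1 := classicalState_num g i
  rw [e, classicalState_num h i] at h1
  cases hg : g i <;> cases hh : h i <;> simp [hg, hh] at h1 ⊢

theorem continuous_classicalState (g : Config) : Continuous (classicalState g).toFun := by
  change Continuous fun A : carAlgebra => inner ℂ (ket g) ((A : Hilb →L[ℂ] Hilb) (ket g))
  fun_prop

/-- The expectation of the superderivation of `q_i^*` in a classical state is the classical energy
of the triple of sites of `q_i`. -/
theorem classicalState_superDer_star_charge (g : Config) (i : ℤ) :
    (classicalState g).toFun (superDer (sites i) (star (charge i))) = (localEnergy i g : ℂ) := by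
  have hmap := map_finsum (classicalState g).toFun
    (superDer_support_finite (star_charge_mem_localAlgebra i))
  rw [superDer, hmap]
  -- As `q_i^*` is odd, the graded commutator is an anticommutator, and each product becomes an
  -- inner product of two vectors.
  have hterm : ∀ j, (classicalState g).toFun
      (charge j * star (charge i) - grading (sites i) (star (charge i)) * charge j) =
      inner ℂ ((star (charge j) : Hilb →L[ℂ] Hilb) (ket g))
          ((star (charge i) : Hilb →L[ℂ] Hilb) (ket g)) +
        inner ℂ ((charge i : Hilb →L[ℂ] Hilb) (ket g)) ((charge j : Hilb →L[ℂ] Hilb) (ket g)) := by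
    intro j
    rw [grading_star_charge, neg_mul, sub_neg_eq_add, map_add, classicalState_mul,
      classicalState_mul, ← StarMemClass.coe_star, ← StarMemClass.coe_star, star_star]
    rfl
  simp only [hterm]
  classical
  obtain ⟨c, hc, hci⟩ := charge_ket i g
  obtain ⟨d, hd, hdi⟩ := star_charge_ket i g
  rw [finsum_eq_single _ i]
  · rw [inner_self_eq_norm_sq_to_K, inner_self_eq_norm_sq_to_K, hci, hdi, localEnergy_eq]
    cases g (2 * i - 1) <;> cases g (2 * i) <;> cases g (2 * i + 1) <;>
      simp [norm_smul, norm_ket, hc, hd]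
  · intro j hj
    obtain ⟨c', -, hcj⟩ := charge_ket j g
    obtain ⟨d', -, hdj⟩ := star_charge_ket j g
    have h1 : flip i g ≠ flip j g := fun e => hj (flip_injective e).symm
    have h2 : flip j g ≠ flip i g := fun e => hj (flip_injective e)
    rw [hci, hdi, hcj, hdj]
    split_ifs <;> simp [inner_smul_left, inner_smul_right, inner_ket_ket, h1, h2]

theorem charge_ket_eq_zero {g : Config} {i : ℤ} (hg : localEnergy i g = 0) :
    (charge i : Hilb →L[ℂ] Hilb) (ket g) = 0 := by
  obtain ⟨c, -, h⟩ := charge_ket i g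
  rw [h, if_neg]
  rintro ⟨h1, h2, h3⟩
  simp [localEnergy_eq, h1, h2, h3] at hg

theorem star_charge_ket_eq_zero {g : Config} {i : ℤ} (hg : localEnergy i g = 0) :
    (star (charge i) : Hilb →L[ℂ] Hilb) (ket g) = 0 := by
  obtain ⟨c, -, h⟩ := star_charge_ket i g
  rw [h, if_neg]
  rintro ⟨h1, h2, h3⟩
  simp [localEnergy_eq, h1, h2, h3] at hg

theorem classicalState_mul_charge {g : Config} {i : ℤ} (hg : localEnergy i g = 0)
    (A : carAlgebra) : (classicalState g).toFun (A * charge i) = 0 := by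
  rw [classicalState_mul, charge_ket_eq_zero hg, inner_zero_right]

theorem classicalState_mul_star_charge {g : Config} {i : ℤ} (hg : localEnergy i g = 0)
    (A : carAlgebra) : (classicalState g).toFun (A * star (charge i)) = 0 := by
  rw [classicalState_mul, StarMemClass.coe_star, star_charge_ket_eq_zero hg, inner_zero_right]

/-- Moved to the left vector, the charge becomes its adjoint, which annihilates `|g⟩` too. -/
theorem classicalState_charge_mul {g : Config} {i : ℤ} (hg : localEnergy i g = 0)
    (A : carAlgebra) : (classicalState g).toFun (charge i * A) = 0 := by
  rw [classicalState_mul, star_charge_ket_eq_zero hg, inner_zero_left]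

theorem isSupersymmetric_classicalState {g : Config} (hg : ∀ i, localEnergy i g = 0) :
    IsSupersymmetric (classicalState g) := by
  intro I A hA
  rw [superDer, map_finsum _ (superDer_support_finite hA)]
  simp only [map_sub, classicalState_charge_mul (hg _), classicalState_mul_charge (hg _),
    sub_zero, finsum_zero]

theorem classicalState_timeGen_nonneg {g : Config} (hg : ∀ i, localEnergy i g = 0)
    {I : Finset ℤ} {A : carAlgebra} (hA : A ∈ localAlgebra I) :
    0 ≤ (classicalState g).toFun (star A * timeGen A) := by
  classical
  have hfin := timeGen_support_finite hA
  -- The support is enlarged to a square `J × J`, adding only zero commutators, so that the double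
  -- sum factors through the single finite supercharge `∑_{i ∈ J} q_i`.
  set J : Finset ℤ := hfin.toFinset.image Prod.fst ∪ hfin.toFinset.image Prod.snd with hJ
  have hsub : (Function.support fun p : ℤ × ℤ =>
      ⁅charge p.1 * star (charge p.2) + star (charge p.2) * charge p.1, A⁆) ⊆ ↑(J ×ˢ J) := by
    intro p hp
    have hp' := hfin.mem_toFinset.2 hp
    rw [Finset.mem_coe, Finset.mem_product, hJ]
    exact ⟨Finset.mem_union_left _ (Finset.mem_image_of_mem _ hp'),
      Finset.mem_union_right _ (Finset.mem_image_of_mem _ hp')⟩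
  -- The other half of the commutator ends in a charge or its adjoint acting on `|g⟩`, hence
  -- vanishes.
  have hterm : ∀ p : ℤ × ℤ, (classicalState g).toFun (star A *
      ⁅charge p.1 * star (charge p.2) + star (charge p.2) * charge p.1, A⁆) =
      (classicalState g).toFun (star A *
        (charge p.1 * star (charge p.2) + star (charge p.2) * charge p.1) * A) := by
    intro p
    rw [Ring.lie_def, mul_sub, map_sub, mul_add A, mul_add (star A) (A * _), map_add]
    simp only [← mul_assoc, classicalState_mul_charge (hg _),
      classicalState_mul_star_charge (hg _), add_zero, sub_zero]
  have hsum : (∑ p ∈ J ×ˢ J, star A *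
      (charge p.1 * star (charge p.2) + star (charge p.2) * charge p.1) * A) =
      star (star (∑ i ∈ J, charge i) * A) * (star (∑ i ∈ J, charge i) * A) +
        star ((∑ i ∈ J, charge i) * A) * ((∑ i ∈ J, charge i) * A) := by
    rw [← Finset.sum_mul, ← Finset.mul_sum, Finset.sum_add_distrib, Finset.sum_product,
      Finset.sum_product_right]
    simp only [← Finset.mul_sum, ← Finset.sum_mul, ← star_sum, star_mul, star_star]
    simp only [mul_add, add_mul, mul_assoc]
  rw [timeGen, finsum_eq_sum_of_support_subset _ hsub, Finset.mul_sum, map_sum,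
    Finset.sum_congr rfl fun p _ => hterm p, ← map_sum, hsum, map_add]
  exact add_nonneg ((classicalState g).nonneg _) ((classicalState g).nonneg _)

theorem isGroundState_classicalState {g : Config} (hg : ∀ i, localEnergy i g = 0) :
    IsGroundState (classicalState g) := by
  have hclosed : IsClosed {p : carAlgebra × carAlgebra |
      0 ≤ (classicalState g).toFun (star p.1 * p.2)} :=
    isClosed_Ici.preimage ((continuous_classicalState g).comp (by fun_prop))
  refine closure_minimal ?_ hclosed
  rintro ⟨A, B⟩ ⟨⟨I, hA⟩, hB⟩
  obtain rfl : B = timeGen A := hB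
  exact classicalState_timeGen_nonneg hg hA

theorem classicalSusyGroundStates_eq :
    classicalSusyGroundStates = classicalState '' {g : Config | ∀ i, localEnergy i g = 0} := by
  ext φ
  constructor
  · rintro ⟨⟨g, rfl⟩, hsusy, -⟩
    refine ⟨g, fun i => ?_, rfl⟩
    -- The test operator `q_i^*` detects the `i`-th local energy.
    have h := classicalState_superDer_star_charge g i
    rw [hsusy _ _ (star_charge_mem_localAlgebra i)] at h
    exact_mod_cast h.symm
  · rintro ⟨g, hg, rfl⟩
    exact ⟨⟨g, rfl⟩, isSupersymmetric_classicalState hg, isGroundState_classicalState hg⟩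

end

end Nicolai

theorem theorem3 :
    Function.Injective Nicolai.classicalState ∧
    Nicolai.classicalSusyGroundStates =
      Nicolai.classicalState '' {g : Nicolai.Config | Nicolai.IsClassicalGround g} ∧
    Nicolai.classicalSusyGroundStates =
      Nicolai.classicalState '' {g : Nicolai.Config | Nicolai.IsClassicalMinimizer g} := by
  simp only [Nicolai.isClassicalGround_iff, Nicolai.isClassicalMinimizer_iff]
  exact ⟨Nicolai.classicalState_injective, Nicolai.classicalSusyGroundStates_eq,
    Nicolai.classicalSusyGroundStates_eq⟩
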